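/- Let $\mathcal M_2$ be the set of conjugacy classes $[f]$, under Möbius transformations, of rational maps $f:\overline{\mathbb C}\to\overline{\mathbb C}$ of degree $2$, and let $J(f)$ denote the Julia set of $f$, i.e. the complement of the largest open set on which the iterates of $f$ are equicontinuous for the spherical metric. Put $$\mathrm{Per}_1(1)=\{[f]\in\mathcal M_2:\ f\text{ has a fixed point with eigenvalue }1\},\qquad \mathbf M_1=\{[f]\in\mathrm{Per}_1(1):\ J(f)\text{ is connected}\}.$$ For $[f]\in\mathrm{Per}_1(1)$ let $\lambda$ be the eigenvalue of $f$ at the other fixed point: if $p$ is a fixed point of $f$ with eigenvalue $1$, then $\lambda$ is the eigenvalue of $f$ at the fixed point $q\ne p$ if there is one, and $\lambda=1$ if $p$ is the only fixed point of $f$. Then: 1. $[f]\mapsto\lambda$ is a well-defined bijection from $\mathrm{Per}_1(1)$ onto $\mathbb C$; we use it to identify $\mathrm{Per}_1(1)$ with $\mathbb C$. 2. In this parametrization, $\mathbf M_1\subset\{\lambda\in\mathbb C:\ |\lambda-1|\le 9\}$. 3. Let $B\in\mathbb C$ with $|B|>3$ and $g_B(z)=z+B+1/z$. The critical points of $g_B$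 are exactly $\pm1$, both critical orbits $(g_B^n(\pm1))_{n\ge0}$ converge to $\infty$, and the Julia set $J(g_B)$ is disconnected. -/

import Mathlib

open Polynomial Filter Topology OnePoint

namespace QuadRat

noncomputable section

/-- The Riemann sphere. -/
abbrev Sphere : Type := OnePoint ℂ

/-- The unique uniform structure compatible with the (compact Hausdorff) topology of the sphere;
it is the one induced by the spherical (or chordal) metric. -/
abbrev sphereUniformSpace : UniformSpace Sphere := uniformSpaceOfCompactR1

/-- The self-map of the sphere given by the quotient `P / Q` (meaningful for coprime `P`, `Q`). -/
def ratMap (P Q : ℂ[X]) (z : Sphere) : Sphere :=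
  z.elim
    (if Q.coeff (max P.natDegree Q.natDegree) = 0 then ∞
      else ((P.coeff (max P.natDegree Q.natDegree) /
        Q.coeff (max P.natDegree Q.natDegree) : ℂ) : Sphere))
    (fun w => if Q.eval w = 0 then ∞ else ((P.eval w / Q.eval w : ℂ) : Sphere))

/-- `f` is a rational map of degree two. -/
def IsQuadratic (f : Sphere → Sphere) : Prop :=
  ∃ P Q : ℂ[X], IsCoprime P Q ∧ max P.natDegree Q.natDegree = 2 ∧ f = ratMap P Q

/-- Two quadratic rational maps are holomorphically conjugate if some Möbius transformation
conjugates one to the other. -/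
instance conjSetoid : Setoid {f : Sphere → Sphere // IsQuadratic f} where
  r f g := ∃ M : GL (Fin 2) ℂ, ∀ z : Sphere, g.1 (M • z) = M • f.1 z
  iseqv :=
    { refl := fun _ => ⟨1, fun z => by simp⟩
      symm := by
        rintro f g ⟨M, hM⟩
        refine ⟨M⁻¹, fun z => ?_⟩
        have h := hM (M⁻¹ • z)
        rw [smul_inv_smul] at h
        rw [h, inv_smul_smul]
      trans := by
        rintro f g h ⟨M, hM⟩ ⟨N, hN⟩
        exact ⟨N * M, fun z => by rw [mul_smul, hN, hM, mul_smul]⟩ }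

/-- The moduli space of quadratic rational maps: holomorphic conjugacy classes. -/
def Moduli : Type := Quotient conjSetoid

/-- The conjugacy class of a quadratic rational map. -/
def cls (f : {f : Sphere → Sphere // IsQuadratic f}) : Moduli := Quotient.mk conjSetoid f

/-- The involution `z ↦ 1 / z` of the sphere. -/
def sphereInv (z : Sphere) : Sphere :=
  z.elim ((0 : ℂ) : Sphere) (fun w => if w = 0 then ∞ else ((w⁻¹ : ℂ) : Sphere))

/-- The affine coordinate on the sphere (with an irrelevant value at `∞`). -/
def coord (z : Sphere) : ℂ := z.elim 0 id

/-- The eigenvalue (multiplier) of a rational map `f` at a fixed point `p`: the derivative of `f`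
at `p`, computed in the coordinate `z` if `p` is finite and in the coordinate `1 / z` if
`p = ∞`. -/
def eigenvalue (f : Sphere → Sphere) (p : Sphere) : ℂ :=
  p.elim (deriv (fun w : ℂ => coord (sphereInv (f (sphereInv (w : Sphere))))) 0)
    (fun z => deriv (fun w : ℂ => coord (f (w : Sphere))) z)

/-- The Fatou set: the largest open set on which the iterates of `f` are equicontinuous. -/
def fatouSet (f : Sphere → Sphere) : Set Sphere :=
  {z | ∃ U : Set Sphere, IsOpen U ∧ z ∈ U ∧
    ∀ w ∈ U, @EquicontinuousAt ℕ Sphere Sphere _ sphereUniformSpace (fun n => f^[n]) w}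

/-- The Julia set. -/
def juliaSet (f : Sphere → Sphere) : Set Sphere := (fatouSet f)ᶜ

/-- Classes of quadratic maps having a fixed point with eigenvalue `1`. -/
def PerOneOne : Set Moduli :=
  {c | ∃ f, cls f = c ∧ ∃ p, f.1 p = p ∧ eigenvalue f.1 p = 1}

/-- Classes in `PerOneOne` whose Julia set is connected. -/
def MOne : Set Moduli :=
  {c | c ∈ PerOneOne ∧ ∃ f, cls f = c ∧ IsConnected (juliaSet f.1)}

/-- `l` is the eigenvalue of `f` at the other fixed point, where `f` is a quadratic map having a
fixed point `p` of eigenvalue `1`. Of the three fixed points counted with multiplicity, `p` takes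
at least two. Either there is a fixed point `q ≠ p`, and `l` is the eigenvalue at `q`, or `p` is
the only fixed point (a triple one), the remaining fixed point is `p` again, and `l = 1`. -/
def IsOtherEigenvalue (f : Sphere → Sphere) (l : ℂ) : Prop :=
  ∃ p, f p = p ∧ eigenvalue f p = 1 ∧
    ((∃ q, q ≠ p ∧ f q = q ∧ eigenvalue f q = l) ∨ ((∀ q, f q = q → q = p) ∧ l = 1))

/-- `l` is the parameter of the class `c`: the eigenvalue at the other fixed point. -/
def IsParameter (c : Moduli) (l : ℂ) : Prop :=
  ∃ f, cls f = c ∧ IsOtherEigenvalue f.1 l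

/-- The map `g_B(z) = z + B + 1/z` of the sphere. -/
def gMap (B : ℂ) (z : Sphere) : Sphere :=
  z.elim ∞ (fun w => if w = 0 then ∞ else ((w + B + 1 / w : ℂ) : Sphere))

/-- A critical point of a rational map: a point near which the map is not injective
(that is, its local degree is at least two). -/
def IsCriticalPoint (f : Sphere → Sphere) (c : Sphere) : Prop :=
  ∀ U ∈ 𝓝 c, ¬ Set.InjOn f U

end

end QuadRat

/-! Send a fixed point of eigenvalue `1` to `∞`. The map becomes `(w² + e w + g) / (w + h)`; putting
the pole at `0` and rescaling turns it into `g_B` (`exists_conj_gMap`). The scale is a square root,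
so `B` is free up to sign, and `z ↦ -z` conjugates `g_B` to `g_{-B}`. The finite fixed point `-1/B`
has eigenvalue `1 - B²`, so `λ = 1 - B²`. Thus `λ` determines `B` up to sign, hence the class, and
every `λ` occurs.

Let `‖B‖ > 3` and measure height along `B`. One step adds at least `‖B‖ - 1` to the height of a
point with `‖z‖ ≥ 1`, so the half-plane of height `> 1` escapes to `∞`. The unit circle, which
contains the critical points `±1`, maps into it and lies in the Fatou set (`coe_mem_fatouSet`).
Backward orbits of `0` reach every neighbourhood of the fixed point `∞`, which puts `∞` in the Julia
set; the symmetry `g_B(1/z) = g_B(z)` does the same for `0`. So the circle separates the Julia set.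
By conjugation invariance, connectedness forces `‖B‖ ≤ 3`, that is `‖λ - 1‖ = ‖B‖² ≤ 9`. -/

namespace QuadRat

noncomputable section

/-! ### Möbius transformations and their continuity on the sphere -/

/-- The matrix of the Möbius transformation `z ↦ 1 / z`. -/
def inversion : GL (Fin 2) ℂ :=
  Matrix.GeneralLinearGroup.mkOfDetNeZero !![0, 1; 1, 0] (by simp)

/-- The matrix of the affine map `z ↦ a z + b`. -/
def affineGL (a b : ℂ) (ha : a ≠ 0) : GL (Fin 2) ℂ :=
  Matrix.GeneralLinearGroup.mkOfDetNeZero !![a, b; 0, 1] (by simpa using ha)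

theorem inversion_smul_coe (w : ℂ) :
    inversion • (w : Sphere) = if w = 0 then ∞ else ((w⁻¹ : ℂ) : Sphere) := by
  rw [smul_some_eq_ite]
  simp [inversion, Matrix.GeneralLinearGroup.mkOfDetNeZero]

theorem inversion_smul_coe_of_ne_zero {w : ℂ} (hw : w ≠ 0) :
    inversion • (w : Sphere) = ((w⁻¹ : ℂ) : Sphere) := by
  rw [inversion_smul_coe, if_neg hw]

theorem inversion_smul_zero : inversion • ((0 : ℂ) : Sphere) = ∞ := by
  rw [inversion_smul_coe, if_pos rfl]

theorem inversion_smul_infty : inversion • (∞ : Sphere) = ((0 : ℂ) : Sphere) := by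
  rw [smul_infty_eq_ite]
  simp [inversion, Matrix.GeneralLinearGroup.mkOfDetNeZero]

theorem inversion_smul (z : Sphere) : inversion • z = sphereInv z := by
  induction z using OnePoint.rec with
  | infty => exact inversion_smul_infty
  | coe w => exact inversion_smul_coe w

theorem inversion_smul_inversion_smul (z : Sphere) : inversion • inversion • z = z := by
  induction z using OnePoint.rec with
  | infty => rw [inversion_smul_infty, inversion_smul_zero]
  | coe w =>
    by_cases hw : w = 0
    · rw [hw, inversion_smul_zero, inversion_smul_infty]
    · rw [inversion_smul_coe_of_ne_zero hw, inversion_smul_coe_of_ne_zero (inv_ne_zero hw), inv_inv]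

theorem inversion_inv_smul (z : Sphere) : inversion⁻¹ • z = inversion • z := by
  rw [inv_smul_eq_iff, inversion_smul_inversion_smul]

theorem affineGL_smul_coe (a b : ℂ) (ha : a ≠ 0) (w : ℂ) :
    affineGL a b ha • (w : Sphere) = ((a * w + b : ℂ) : Sphere) := by
  rw [smul_some_eq_ite]
  simp [affineGL, Matrix.GeneralLinearGroup.mkOfDetNeZero]

theorem affineGL_smul_infty (a b : ℂ) (ha : a ≠ 0) :
    affineGL a b ha • (∞ : Sphere) = ∞ := by
  rw [smul_infty_eq_ite]
  simp [affineGL, Matrix.GeneralLinearGroup.mkOfDetNeZero]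

@[simp] theorem coord_coe (w : ℂ) : coord (w : Sphere) = w := rfl

/-- Near a point which it does not send to `∞`, a Möbius transformation is given by a
differentiable function of the coordinate. -/
theorem exists_hasDerivAt_of_smul_coe_eq {N : GL (Fin 2) ℂ} {t s : ℂ}
    (h : N • (t : Sphere) = (s : Sphere)) :
    ∃ (m : ℂ → ℂ) (a : ℂ), HasDerivAt m a t ∧ m t = s ∧
      ∀ᶠ w : ℂ in 𝓝 t, N • (w : Sphere) = (m w : Sphere) := by
  rw [smul_some_eq_ite] at h
  split_ifs at h with h0
  · exact absurd h (infty_ne_coe _)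
  · have hd : HasDerivAt (fun w : ℂ => N 1 0 * w + N 1 1) (N 1 0) t := by
      simpa using ((hasDerivAt_id t).const_mul (N 1 0)).add_const (N 1 1)
    have hn : HasDerivAt (fun w : ℂ => N 0 0 * w + N 0 1) (N 0 0) t := by
      simpa using ((hasDerivAt_id t).const_mul (N 0 0)).add_const (N 0 1)
    refine ⟨_, _, hn.div hd h0, coe_injective h, ?_⟩
    filter_upwards [hd.continuousAt.eventually_ne h0] with w hw
    rw [smul_some_eq_ite, if_neg hw]
    rfl

theorem continuous_inversion_smul : Continuous fun z : Sphere => inversion • z := by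
  refine (OnePoint.continuous_iff _).2 ⟨?_, ?_⟩
  · rw [inversion_smul_infty, coclosedCompact_eq_cocompact, ← Metric.cobounded_eq_cocompact]
    refine Tendsto.congr' ?_ ((continuous_coe.tendsto (0 : ℂ)).comp tendsto_inv₀_cobounded)
    filter_upwards [Bornology.eventually_ne_cobounded (0 : ℂ)] with w hw
    exact (inversion_smul_coe_of_ne_zero hw).symm
  · refine continuous_iff_continuousAt.2 fun w => ?_
    by_cases hw : w = 0
    · subst hw
      rw [continuousAt_iff_punctured_nhds, inversion_smul_zero]
      have h : Tendsto (fun w : ℂ => ((w⁻¹ : ℂ) : Sphere)) (𝓝[≠] 0) (𝓝 ∞) := by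
        refine tendsto_coe_infty.comp ?_
        rw [coclosedCompact_eq_cocompact, ← Metric.cobounded_eq_cocompact]
        exact tendsto_inv₀_nhdsNE_zero
      refine h.congr' ?_
      filter_upwards [self_mem_nhdsWithin] with w hw
      exact (inversion_smul_coe_of_ne_zero hw).symm
    · have h : ContinuousAt (fun w : ℂ => ((w⁻¹ : ℂ) : Sphere)) w :=
        continuous_coe.continuousAt.comp (continuousAt_inv₀ hw)
      refine h.congr ?_
      filter_upwards [eventually_ne_nhds hw] with w hw
      exact (inversion_smul_coe_of_ne_zero hw).symm

theorem continuousAt_smul_coe_of_ne_infty {N : GL (Fin 2) ℂ} {t : ℂ}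
    (h : N • (t : Sphere) ≠ ∞) : ContinuousAt (fun z : Sphere => N • z) t := by
  obtain ⟨s, hs⟩ := ne_infty_iff_exists.1 h
  obtain ⟨m, a, hm, -, hN⟩ := exists_hasDerivAt_of_smul_coe_eq hs.symm
  rw [continuousAt_coe]
  refine ContinuousAt.congr (f := fun w => (m w : Sphere)) ?_ ?_
  · exact continuous_coe.continuousAt.comp hm.continuousAt
  · filter_upwards [hN] with w hw using hw.symm

theorem continuousAt_smul_coe (N : GL (Fin 2) ℂ) (t : ℂ) :
    ContinuousAt (fun z : Sphere => N • z) t := by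
  by_cases h : N • (t : Sphere) = ∞
  -- A pole is moved to `0` by composing with the inversion, which is its own inverse and already
  -- known to be continuous.
  · have h1 : (inversion * N) • (t : Sphere) ≠ ∞ := by
      rw [mul_smul, h, inversion_smul_infty]
      exact coe_ne_infty _
    have h2 := continuous_inversion_smul.continuousAt.comp
      (continuousAt_smul_coe_of_ne_infty h1)
    refine h2.congr (Eventually.of_forall fun z => ?_)
    simp only [Function.comp_apply, mul_smul, inversion_smul_inversion_smul]
  · exact continuousAt_smul_coe_of_ne_infty h

theorem continuous_smul_sphere (N : GL (Fin 2) ℂ) : Continuous fun z : Sphere => N • z := by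
  refine continuous_iff_continuousAt.2 fun z => ?_
  induction z using OnePoint.rec with
  | infty =>
    have h1 := continuousAt_smul_coe (N * inversion) 0
    have h2 : ContinuousAt (fun z : Sphere => inversion • z) ∞ :=
      continuous_inversion_smul.continuousAt
    rw [← inversion_smul_infty] at h1
    refine (ContinuousAt.comp (f := fun z : Sphere => inversion • z) h1 h2).congr
      (Eventually.of_forall fun z => ?_)
    simp only [Function.comp_apply, mul_smul, inversion_smul_inversion_smul]
  | coe t => exact continuousAt_smul_coe N t

/-! ### Multipliers in arbitrary Möbius coordinates -/

/-- In some Möbius coordinate at its fixed point `p`, the map `f` is given by a function with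
derivative `μ`. -/
def HasMultiplier (f : Sphere → Sphere) (p : Sphere) (μ : ℂ) : Prop :=
  ∃ (N : GL (Fin 2) ℂ) (t : ℂ) (F : ℂ → ℂ), N • (t : Sphere) = p ∧ F t = t ∧ HasDerivAt F μ t ∧
    ∀ᶠ w : ℂ in 𝓝 t, f (N • (w : Sphere)) = N • (F w : Sphere)

theorem HasMultiplier.conj {f g : Sphere → Sphere} {p : Sphere} {μ : ℂ}
    (h : HasMultiplier f p μ) {M : GL (Fin 2) ℂ} (hM : ∀ z, g (M • z) = M • f z) :
    HasMultiplier g (M • p) μ := by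
  obtain ⟨N, t, F, hp, ht, hF, hf⟩ := h
  refine ⟨M * N, t, F, by rw [mul_smul, hp], ht, hF, ?_⟩
  filter_upwards [hf] with w hw
  rw [mul_smul, hM, hw, mul_smul]

/-- The transition maps `m` and `n` between two charts are mutually inverse, so their derivatives
satisfy `a * b = 1` and cancel in the chain rule. This makes the multiplier independent of the
chart. -/
theorem HasMultiplier.deriv_eq {f : Sphere → Sphere} {p : Sphere} {μ : ℂ}
    (h : HasMultiplier f p μ) {K : GL (Fin 2) ℂ} {s : ℂ} (hK : K • (s : Sphere) = p) :
    deriv (fun w : ℂ => coord (K⁻¹ • f (K • (w : Sphere)))) s = μ := by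
  obtain ⟨N, t, F, hp, ht, hF, hf⟩ := h
  have h1 : (K⁻¹ * N) • (t : Sphere) = s := by rw [mul_smul, hp, ← hK, inv_smul_smul]
  have h2 : (N⁻¹ * K) • (s : Sphere) = t := by rw [mul_smul, hK, ← hp, inv_smul_smul]
  obtain ⟨m, a, hm, hmt, hm'⟩ := exists_hasDerivAt_of_smul_coe_eq h1
  obtain ⟨n, b, hn, hns, hn'⟩ := exists_hasDerivAt_of_smul_coe_eq h2
  have htn : Tendsto n (𝓝 s) (𝓝 t) := by simpa [hns] using hn.continuousAt.tendsto
  have htF : Tendsto F (𝓝 t) (𝓝 t) := by simpa [ht] using hF.continuousAt.tendsto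
  have hmn : HasDerivAt (fun w => m (n w)) (a * b) s :=
    HasDerivAt.comp s (by rw [hns]; exact hm) hn
  have hid : (fun w => m (n w)) =ᶠ[𝓝 s] id := by
    filter_upwards [hn', htn.eventually hm'] with w hw1 hw2
    refine coe_injective ?_
    rw [← hw2, ← hw1, ← mul_smul, mul_assoc, mul_inv_cancel_left, inv_mul_cancel, one_smul]
    rfl
  have hab : a * b = 1 := (hmn.congr_of_eventuallyEq hid.symm).unique (hasDerivAt_id s)
  have hFn : HasDerivAt (fun w => F (n w)) (μ * b) s :=
    HasDerivAt.comp s (by rw [hns]; exact hF) hn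
  have hall : HasDerivAt (fun w => m (F (n w))) (a * (μ * b)) s :=
    HasDerivAt.comp s (by rw [hns, ht]; exact hm) hFn
  have heq : (fun w : ℂ => coord (K⁻¹ • f (K • (w : Sphere)))) =ᶠ[𝓝 s]
      fun w => m (F (n w)) := by
    filter_upwards [hn', htn.eventually hf, htn.eventually (htF.eventually hm')] with w h1 h2 h3
    have h4 : K • (w : Sphere) = N • (n w : Sphere) := by
      rw [← h1, mul_smul, smul_inv_smul]
    rw [h4, h2, ← mul_smul, h3, coord_coe]
  rw [heq.deriv_eq, hall.deriv]
  linear_combination μ * hab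

theorem HasMultiplier.eigenvalue_eq {f : Sphere → Sphere} {p : Sphere} {μ : ℂ}
    (h : HasMultiplier f p μ) : eigenvalue f p = μ := by
  induction p using OnePoint.rec with
  | infty =>
    have h1 := h.deriv_eq inversion_smul_zero
    simp only [inversion_inv_smul, inversion_smul] at h1
    exact h1
  | coe t =>
    have h1 := h.deriv_eq (one_smul _ (t : Sphere))
    simp only [inv_one, one_smul] at h1
    exact h1

/-! ### The family `g_B`: fixed points and eigenvalues -/

@[simp] theorem gMap_infty (B : ℂ) : gMap B ∞ = ∞ := rfl

theorem gMap_coe (B w : ℂ) :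
    gMap B (w : Sphere) = if w = 0 then ∞ else ((w + B + 1 / w : ℂ) : Sphere) := rfl

@[simp] theorem gMap_zero (B : ℂ) : gMap B ((0 : ℂ) : Sphere) = ∞ := by
  rw [gMap_coe, if_pos rfl]

theorem gMap_coe_of_ne_zero (B : ℂ) {w : ℂ} (hw : w ≠ 0) :
    gMap B (w : Sphere) = ((w + B + 1 / w : ℂ) : Sphere) := by
  rw [gMap_coe, if_neg hw]

theorem isQuadratic_gMap (B : ℂ) : IsQuadratic (gMap B) := by
  have hP : (X ^ 2 + C B * X + 1 : ℂ[X]).natDegree = 2 := by compute_degree!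
  have hm : max (X ^ 2 + C B * X + 1 : ℂ[X]).natDegree (X : ℂ[X]).natDegree = 2 := by
    rw [hP, natDegree_X]; norm_num
  refine ⟨X ^ 2 + C B * X + 1, X, ⟨1, -(X + C B), by ring⟩, hm, ?_⟩
  funext z
  induction z using OnePoint.rec with
  | infty =>
    simp only [ratMap, OnePoint.elim_infty, hm, gMap_infty]
    rw [if_pos]
    simp [coeff_X]
  | coe w =>
    simp only [ratMap, OnePoint.elim_some, eval_X, gMap_coe]
    split_ifs with hw
    · rfl
    · congr 1
      simp only [eval_add, eval_pow, eval_X, eval_mul, eval_C, eval_one]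
      field_simp

theorem gMap_coe_eq_self_iff (B w : ℂ) : gMap B (w : Sphere) = w ↔ B * w = -1 := by
  by_cases hw : w = 0
  · subst hw
    simp [infty_ne_coe]
  · rw [gMap_coe_of_ne_zero B hw, coe_eq_coe]
    constructor
    · intro h
      field_simp at h
      linear_combination h
    · intro h
      field_simp
      linear_combination h

theorem hasDerivAt_quadratic (a b c w : ℂ) :
    HasDerivAt (fun w : ℂ => a + b * w + c * w ^ 2) (b + 2 * c * w) w := by
  refine ((((hasDerivAt_id w).const_mul b).const_add a).fun_add
    ((hasDerivAt_pow 2 w).const_mul c)).congr_deriv ?_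
  simp
  ring

theorem hasMultiplier_gMap_infty (B : ℂ) : HasMultiplier (gMap B) ∞ 1 := by
  -- In the coordinate `1/z` the map is `w / (1 + B w + w²)`.
  have hd : HasDerivAt (fun w : ℂ => 1 + B * w + 1 * w ^ 2) B 0 :=
    (hasDerivAt_quadratic 1 B 1 0).congr_deriv (by simp)
  have hF : HasDerivAt (fun w : ℂ => w / (1 + B * w + 1 * w ^ 2)) 1 0 :=
    ((hasDerivAt_id (0 : ℂ)).fun_div hd (by simp)).congr_deriv (by simp)
  refine ⟨inversion, 0, fun w => w / (1 + B * w + 1 * w ^ 2), inversion_smul_zero, by simp, hF, ?_⟩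
  filter_upwards [hd.continuousAt.eventually_ne (y := 0) (by simp)] with w hw
  by_cases h0 : w = 0
  · subst h0
    simp [inversion_smul_zero]
  · rw [inversion_smul_coe_of_ne_zero h0, gMap_coe_of_ne_zero _ (inv_ne_zero h0),
      inversion_smul_coe_of_ne_zero (div_ne_zero h0 hw)]
    congr 1
    field_simp

theorem hasMultiplier_gMap_coe {B w : ℂ} (h : B * w = -1) :
    HasMultiplier (gMap B) (w : Sphere) (1 - B ^ 2) := by
  have hw : w ≠ 0 := by
    rintro rfl
    simp at h
  have hF : HasDerivAt (fun w : ℂ => w + B + w⁻¹) (1 - B ^ 2) w := by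
    refine (((hasDerivAt_id w).add_const B).fun_add (hasDerivAt_inv hw)).congr_deriv ?_
    field_simp
    linear_combination (B * w - 1) * h
  have hfix := (gMap_coe_eq_self_iff B w).2 h
  rw [gMap_coe_of_ne_zero B hw, coe_eq_coe, one_div] at hfix
  refine ⟨1, w, _, one_smul _ _, hfix, hF, ?_⟩
  filter_upwards [eventually_ne_nhds hw] with x hx
  rw [one_smul, one_smul, gMap_coe_of_ne_zero B hx, one_div]

/-- A sphere map conjugate to `g_B` has `1 - B²` as its only other eigenvalue. -/
theorem isOtherEigenvalue_iff_of_conj {f : Sphere → Sphere} {B : ℂ} {M : GL (Fin 2) ℂ}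
    (hM : ∀ z, f (M • z) = M • gMap B z) (l : ℂ) : IsOtherEigenvalue f l ↔ l = 1 - B ^ 2 := by
  have hfix : ∀ z, f (M • z) = M • z ↔ gMap B z = z := fun z => by
    rw [hM, smul_left_cancel_iff]
  have hinf : eigenvalue f (M • ∞) = 1 := ((hasMultiplier_gMap_infty B).conj hM).eigenvalue_eq
  have hfin : ∀ {w : ℂ}, B * w = -1 → eigenvalue f (M • (w : Sphere)) = 1 - B ^ 2 := fun h =>
    ((hasMultiplier_gMap_coe h).conj hM).eigenvalue_eq
  constructor
  · rintro ⟨p, hp, hp1, h⟩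
    obtain ⟨p, rfl⟩ : ∃ p', M • p' = p := ⟨M⁻¹ • p, smul_inv_smul _ _⟩
    rw [hfix] at hp
    -- A finite fixed point has eigenvalue `1 - B²`; if this is `1` then `B = 0`, but `g_0` has no
    -- finite fixed point.
    have hpinf : p = ∞ := by
      induction p using OnePoint.rec with
      | infty => rfl
      | coe w =>
        exfalso
        have hw := (gMap_coe_eq_self_iff B w).1 hp
        rw [hfin hw] at hp1
        have hB : B = 0 := by simpa using hp1
        simp [hB] at hw
    subst hpinf
    rcases h with ⟨q, hqp, hq, hql⟩ | ⟨huniq, rfl⟩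
    · obtain ⟨q, rfl⟩ : ∃ q', M • q' = q := ⟨M⁻¹ • q, smul_inv_smul _ _⟩
      rw [hfix] at hq
      induction q using OnePoint.rec with
      | infty => exact absurd rfl hqp
      | coe w => rw [← hql, hfin ((gMap_coe_eq_self_iff B w).1 hq)]
    · by_contra hB
      have hB0 : B ≠ 0 := by
        rintro rfl
        simp at hB
      have h1 := huniq (M • ((-B⁻¹ : ℂ) : Sphere))
        ((hfix _).2 ((gMap_coe_eq_self_iff _ _).2 (by field_simp)))
      rw [smul_left_cancel_iff] at h1
      exact coe_ne_infty _ h1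
  · rintro rfl
    refine ⟨M • ∞, (hfix _).2 rfl, hinf, ?_⟩
    by_cases hB : B = 0
    · subst hB
      refine Or.inr ⟨fun q hq => ?_, by simp⟩
      obtain ⟨q, rfl⟩ : ∃ q', M • q' = q := ⟨M⁻¹ • q, smul_inv_smul _ _⟩
      rw [hfix] at hq
      induction q using OnePoint.rec with
      | infty => rfl
      | coe w =>
        have := (gMap_coe_eq_self_iff _ _).1 hq
        simp at this
    · have hB' : B * -B⁻¹ = -1 := by field_simp
      refine Or.inl ⟨M • ((-B⁻¹ : ℂ) : Sphere), ?_,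
        (hfix _).2 ((gMap_coe_eq_self_iff _ _).2 hB'), hfin hB'⟩
      rw [Ne, smul_left_cancel_iff]
      exact coe_ne_infty _

theorem gMap_neg_conj (B : ℂ) (z : Sphere) :
    gMap (-B) (affineGL (-1) 0 (by simp) • z) = affineGL (-1) 0 (by simp) • gMap B z := by
  induction z using OnePoint.rec with
  | infty => simp only [affineGL_smul_infty, gMap_infty]
  | coe w =>
    by_cases hw : w = 0
    · subst hw
      simp only [affineGL_smul_coe, mul_zero, add_zero, gMap_zero, affineGL_smul_infty]
    · rw [affineGL_smul_coe, gMap_coe_of_ne_zero B hw, affineGL_smul_coe,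
        gMap_coe_of_ne_zero _ (by simpa using hw)]
      rw [coe_eq_coe]
      have e : -1 * w + 0 = -w := by ring
      rw [e, one_div, one_div, inv_neg]
      ring

/-! ### Reduction to the normal form `g_B` -/

theorem eval_eq_of_natDegree_le_two {P : ℂ[X]} (hP : P.natDegree ≤ 2) (w : ℂ) :
    P.eval w = P.coeff 0 + P.coeff 1 * w + P.coeff 2 * w ^ 2 := by
  rw [eval_eq_sum_range' (Nat.lt_succ_of_le hP)]
  simp [Finset.sum_range_succ]

/-- A quadratic rational map in terms of the coefficients of its numerator and denominator. -/
theorem IsQuadratic.exists_coeff {f : Sphere → Sphere} (hf : IsQuadratic f) :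
    ∃ p₀ p₁ p₂ q₀ q₁ q₂ : ℂ,
      (∀ w, p₀ + p₁ * w + p₂ * w ^ 2 = 0 → q₀ + q₁ * w + q₂ * w ^ 2 ≠ 0) ∧
      (p₂ = 0 → q₂ ≠ 0) ∧
      f ∞ = (if q₂ = 0 then ∞ else ((p₂ / q₂ : ℂ) : Sphere)) ∧
      ∀ w : ℂ, f w = if q₀ + q₁ * w + q₂ * w ^ 2 = 0 then ∞
        else (((p₀ + p₁ * w + p₂ * w ^ 2) / (q₀ + q₁ * w + q₂ * w ^ 2) : ℂ) : Sphere) := by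
  obtain ⟨P, Q, ⟨u, v, huv⟩, hm, rfl⟩ := hf
  have hP : P.natDegree ≤ 2 := hm ▸ le_max_left _ _
  have hQ : Q.natDegree ≤ 2 := hm ▸ le_max_right _ _
  refine ⟨P.coeff 0, P.coeff 1, P.coeff 2, Q.coeff 0, Q.coeff 1, Q.coeff 2, ?_, ?_, ?_, ?_⟩
  · intro w h1 h2
    rw [← eval_eq_of_natDegree_le_two hP] at h1
    rw [← eval_eq_of_natDegree_le_two hQ] at h2
    have := congrArg (eval w) huv
    simp [h1, h2] at this
  · intro h1 h2
    have key : ∀ R : ℂ[X], R.natDegree = 2 → R.coeff 2 ≠ 0 := fun R hR hR2 => by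
      have h : R.leadingCoeff = 0 := by rw [leadingCoeff, hR, hR2]
      rw [leadingCoeff_eq_zero] at h
      simp [h] at hR
    rcases max_choice P.natDegree Q.natDegree with h | h
    · exact key P (h ▸ hm) h1
    · exact key Q (h ▸ hm) h2
  · simp only [ratMap, OnePoint.elim_infty, hm]
  · intro w
    simp only [ratMap, OnePoint.elim_some, eval_eq_of_natDegree_le_two hP,
      eval_eq_of_natDegree_le_two hQ]

/-- With `u = w + h`, division gives `f + h = u + (e - h) + (h² - e h + g) / u`. Scaling by a root
`k` of `k² = h² - e h + g` makes the last coefficient `1`. The quantity under the root is the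
numerator at the pole, nonzero for a coprime fraction. -/
theorem exists_conj_gMap_of_eq {f : Sphere → Sphere} {e g h : ℂ} (hinf : f ∞ = ∞)
    (hf : ∀ w : ℂ, f w = if w + h = 0 then ∞
      else (((w ^ 2 + e * w + g) / (w + h) : ℂ) : Sphere))
    (hne : h ^ 2 - e * h + g ≠ 0) :
    ∃ (B : ℂ) (M : GL (Fin 2) ℂ), ∀ z, gMap B (M • z) = M • f z := by
  obtain ⟨k, hk⟩ := IsAlgClosed.exists_pow_nat_eq (h ^ 2 - e * h + g) (n := 2) (by norm_num)
  have hk0 : k ≠ 0 := by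
    rintro rfl
    simp [← hk] at hne
  refine ⟨(e - h) / k, affineGL k⁻¹ (h / k) (inv_ne_zero hk0), fun z => ?_⟩
  induction z using OnePoint.rec with
  | infty => rw [affineGL_smul_infty, hinf, affineGL_smul_infty, gMap_infty]
  | coe w =>
    have hw' : k⁻¹ * w + h / k = (w + h) / k := by field_simp
    rw [hf, affineGL_smul_coe, hw']
    by_cases hw : w + h = 0
    · rw [if_pos hw, hw, zero_div, gMap_zero, affineGL_smul_infty]
    · rw [if_neg hw, affineGL_smul_coe, gMap_coe_of_ne_zero _ (div_ne_zero hw hk0)]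
      congr 1
      field_simp
      linear_combination hk

theorem exists_conj_gMap_of_infty {f : Sphere → Sphere} (hf : IsQuadratic f) (hp : f ∞ = ∞)
    (h1 : eigenvalue f ∞ = 1) :
    ∃ (B : ℂ) (M : GL (Fin 2) ℂ), ∀ z, gMap B (M • z) = M • f z := by
  obtain ⟨p₀, p₁, p₂, q₀, q₁, q₂, hcop, hdeg, hinf, hfin⟩ := hf.exists_coeff
  have hq₂ : q₂ = 0 := by
    by_contra h
    rw [hinf, if_neg h] at hp
    exact coe_ne_infty _ hp
  subst hq₂
  have hp₂ : p₂ ≠ 0 := fun h => hdeg h rfl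
  have hchart : (fun w : ℂ => coord (sphereInv (f (sphereInv (w : Sphere))))) =
      fun w => (0 + q₁ * w + q₀ * w ^ 2) / (p₂ + p₁ * w + p₀ * w ^ 2) := by
    funext w
    by_cases hw : w = 0
    · subst hw
      rw [← inversion_smul, ← inversion_smul, inversion_smul_zero, hp, inversion_smul_infty]
      simp
    · rw [← inversion_smul, ← inversion_smul, inversion_smul_coe_of_ne_zero hw, hfin]
      have e1 : 0 + q₁ * w + q₀ * w ^ 2 = w ^ 2 * (q₀ + q₁ * w⁻¹ + 0 * w⁻¹ ^ 2) := by
        field_simp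
        ring
      have e2 : p₂ + p₁ * w + p₀ * w ^ 2 = w ^ 2 * (p₀ + p₁ * w⁻¹ + p₂ * w⁻¹ ^ 2) := by
        field_simp
        ring
      rw [e1, e2, mul_div_mul_left _ _ (pow_ne_zero 2 hw)]
      by_cases hQ : q₀ + q₁ * w⁻¹ + 0 * w⁻¹ ^ 2 = 0
      · rw [if_pos hQ, inversion_smul_infty, hQ, zero_div, coord_coe]
      · rw [if_neg hQ, inversion_smul_coe]
        split_ifs with hP
        · rw [← inv_div, hP, inv_zero]
          rfl
        · rw [inv_div, coord_coe]
  -- The derivative at `0` of the expression in the coordinate `1/z` is `q₁ / p₂`.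
  have h2 : q₁ = p₂ := by
    have hd := (hasDerivAt_quadratic 0 q₁ q₀ 0).div (hasDerivAt_quadratic p₂ p₁ p₀ 0)
      (by simpa using hp₂)
    have h1' : deriv (fun w : ℂ => coord (sphereInv (f (sphereInv (w : Sphere))))) 0 = 1 := h1
    rw [hchart] at h1'
    have h3 := hd.deriv.symm.trans h1'
    simp only [mul_zero, add_zero, ne_eq, OfNat.ofNat_ne_zero, not_false_eq_true,
      zero_pow, sub_zero, zero_mul] at h3
    field_simp at h3
    exact h3
  subst h2
  refine exists_conj_gMap_of_eq (e := p₁ / q₁) (g := p₀ / q₁) (h := q₀ / q₁) hp (fun w => ?_) ?_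
  · have e1 : q₀ + q₁ * w + 0 * w ^ 2 = q₁ * (w + q₀ / q₁) := by
      field_simp
      ring
    have e2 : p₀ + p₁ * w + q₁ * w ^ 2 = q₁ * (w ^ 2 + p₁ / q₁ * w + p₀ / q₁) := by
      field_simp
      ring
    rw [hfin, e1, e2, mul_div_mul_left _ _ hp₂]
    simp only [mul_eq_zero, hp₂, false_or]
  · intro h
    refine hcop (-(q₀ / q₁)) ?_ ?_
    · rw [← mul_zero q₁, ← h]
      field_simp
      ring
    · field_simp
      ring

theorem exists_conj_gMap_of_coe {f : Sphere → Sphere} (hf : IsQuadratic f) {p : ℂ}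
    (hp : f p = p) (h1 : eigenvalue f p = 1) :
    ∃ (B : ℂ) (M : GL (Fin 2) ℂ), ∀ z, gMap B (M • z) = M • f z := by
  obtain ⟨p₀, p₁, p₂, q₀, q₁, q₂, hcop, hdeg, hinf, hfin⟩ := hf.exists_coeff
  set c := q₀ + q₁ * p + q₂ * p ^ 2 with hc
  have hc0 : c ≠ 0 := by
    intro h
    rw [hfin, if_pos h] at hp
    exact infty_ne_coe _ hp
  have hPp : p₀ + p₁ * p + p₂ * p ^ 2 = p * c := by
    rw [hfin, if_neg hc0, coe_eq_coe, div_eq_iff hc0] at hp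
    exact hp
  -- For numerator `P` and denominator `Q`, this says that `P - p Q`, which vanishes at `p`, has
  -- derivative `c = Q(p)` there.
  have hder : p₁ + 2 * p₂ * p - p * (q₁ + 2 * q₂ * p) = c := by
    have hd := (hasDerivAt_quadratic p₀ p₁ p₂ p).div (hasDerivAt_quadratic q₀ q₁ q₂ p) hc0
    have h1' : deriv (fun w : ℂ => coord (f (w : Sphere))) p = 1 := h1
    have heq : (fun w : ℂ => coord (f (w : Sphere))) =ᶠ[𝓝 p]
        fun w => (p₀ + p₁ * w + p₂ * w ^ 2) / (q₀ + q₁ * w + q₂ * w ^ 2) := by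
      filter_upwards [(hasDerivAt_quadratic q₀ q₁ q₂ p).continuousAt.eventually_ne hc0] with w hw
      rw [hfin, if_neg hw, coord_coe]
    rw [heq.deriv_eq] at h1'
    have h3 := hd.deriv.symm.trans h1'
    rw [← hc, hPp] at h3
    field_simp at h3
    linear_combination h3
  -- `N` is `z ↦ 1 / (z - p)`. In this coordinate the map is `Q / (P - p Q)`; expanding both at `p`
  -- gives the shape required by `exists_conj_gMap_of_eq`.
  set N : GL (Fin 2) ℂ := inversion * affineGL 1 (-p) one_ne_zero with hN
  have hNinf : N • (∞ : Sphere) = ((0 : ℂ) : Sphere) := by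
    rw [hN, mul_smul, affineGL_smul_infty, inversion_smul_infty]
  have hNp : N • (p : Sphere) = ∞ := by
    rw [hN, mul_smul, affineGL_smul_coe, one_mul, add_neg_cancel, inversion_smul_zero]
  have hNcoe : ∀ {w : ℂ}, w ≠ p → N • (w : Sphere) = (((w - p)⁻¹ : ℂ) : Sphere) := fun {w} hw => by
    rw [hN, mul_smul, affineGL_smul_coe, one_mul, ← sub_eq_add_neg,
      inversion_smul_coe_of_ne_zero (sub_ne_zero.2 hw)]
  have hNinv : ∀ {w : ℂ}, w ≠ 0 → N⁻¹ • (w : Sphere) = ((p + w⁻¹ : ℂ) : Sphere) := fun {w} hw => by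
    rw [inv_smul_eq_iff, hNcoe (by simpa using hw), add_sub_cancel_left, inv_inv]
  have hval : ∀ {A D : ℂ}, (A = 0 → D ≠ 0) → ∀ {s : Sphere},
      s = (if A = 0 then ∞ else (((D + p * A) / A : ℂ) : Sphere)) →
      N • s = if D = 0 then ∞ else ((A / D : ℂ) : Sphere) := by
    rintro A D hAD s rfl
    by_cases hA : A = 0
    · rw [if_pos hA, if_neg (hAD hA), hNinf, hA, zero_div]
    · have e : (D + p * A) / A = D / A + p := by field_simp
      rw [if_neg hA, e]
      by_cases hD : D = 0
      · rw [hD, zero_div, zero_add, hNp, if_pos rfl]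
      · rw [hNcoe (by simp [hA, hD]), if_neg hD, add_sub_cancel_right, inv_div]
  obtain ⟨B, M, hM⟩ : ∃ (B : ℂ) (M : GL (Fin 2) ℂ),
      ∀ z, gMap B (M • z) = M • (N • f (N⁻¹ • z)) := by
    refine exists_conj_gMap_of_eq (e := (q₁ + 2 * q₂ * p) / c) (g := q₂ / c)
      (h := (p₂ - p * q₂) / c) ?_ (fun w => ?_) ?_
    · rw [inv_smul_eq_iff.2 hNp.symm, hp, hNp]
    · by_cases hw : w = 0
      · subst hw
        rw [inv_smul_eq_iff.2 hNinf.symm]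
        have hAD : q₂ = 0 → p₂ - p * q₂ ≠ 0 := fun h1 h2 => hdeg (by simpa [h1] using h2) h1
        rw [hval hAD (by rw [hinf, sub_add_cancel])]
        have e1 : (0 : ℂ) + (p₂ - p * q₂) / c = (p₂ - p * q₂) / c := zero_add _
        have e2 : (0 : ℂ) ^ 2 + (q₁ + 2 * q₂ * p) / c * 0 + q₂ / c = q₂ / c := by ring
        rw [e1, e2, div_div_div_cancel_right₀ hc0]
        simp only [div_eq_zero_iff, hc0, or_false]
      · rw [hNinv hw]
        have eA : q₀ + q₁ * (p + w⁻¹) + q₂ * (p + w⁻¹) ^ 2 =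
            c / w ^ 2 * (w ^ 2 + (q₁ + 2 * q₂ * p) / c * w + q₂ / c) := by
          field_simp
          rw [hc]
          ring
        have eD : p₀ + p₁ * (p + w⁻¹) + p₂ * (p + w⁻¹) ^ 2 -
            p * (q₀ + q₁ * (p + w⁻¹) + q₂ * (p + w⁻¹) ^ 2) =
            c / w ^ 2 * (w + (p₂ - p * q₂) / c) := by
          field_simp
          linear_combination w ^ 2 * hPp - w ^ 2 * p * hc + w * hder
        have hcw : c / w ^ 2 ≠ 0 := div_ne_zero hc0 (pow_ne_zero 2 hw)
        rw [hval (s := f ((p + w⁻¹ : ℂ) : Sphere)) (fun h1 h2 => ?_)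
          (by rw [hfin, sub_add_cancel]), eD, eA, mul_div_mul_left _ _ hcw]
        · simp only [mul_eq_zero, hcw, false_or]
        · rw [h1, mul_zero, sub_zero] at h2
          exact hcop _ h2 h1
    · intro h
      -- If the numerator vanished at the pole, `P` and `Q` would share the root `p - c / b`; when
      -- `b = 0` that root is at `∞` and the degree drops.
      by_cases hb : p₂ - p * q₂ = 0
      · have hq : q₂ = 0 := by simpa [hb, hc0] using h
        exact hdeg (by simpa [hq] using hb) hq
      · set b := p₂ - p * q₂ with hb'
        have hQ : q₀ + q₁ * (p - c / b) + q₂ * (p - c / b) ^ 2 = 0 := by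
          have e : q₀ + q₁ * (p - c / b) + q₂ * (p - c / b) ^ 2 =
              c - (q₁ + 2 * q₂ * p) * (c / b) + q₂ * (c / b) ^ 2 := by
            rw [hc]
            ring
          rw [e]
          field_simp at h ⊢
          linear_combination c * h
        refine hcop (p - c / b) ?_ hQ
        have e : p₀ + p₁ * (p - c / b) + p₂ * (p - c / b) ^ 2 =
            p * (q₀ + q₁ * (p - c / b) + q₂ * (p - c / b) ^ 2) - c * (c / b) + b * (c / b) ^ 2 := by
          rw [hb']
          linear_combination hPp - p * hc - (c / (p₂ - p * q₂)) * hder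
        rw [e, hQ]
        field_simp
        ring
  refine ⟨B, M * N, fun z => ?_⟩
  rw [mul_smul M N, hM, inv_smul_smul, mul_smul M N]

/-- A quadratic rational map with a fixed point of eigenvalue `1` is conjugate to some `g_B`. -/
theorem exists_conj_gMap {f : Sphere → Sphere} (hf : IsQuadratic f) {p : Sphere}
    (hp : f p = p) (h1 : eigenvalue f p = 1) :
    ∃ (B : ℂ) (M : GL (Fin 2) ℂ), ∀ z, gMap B (M • z) = M • f z := by
  induction p using OnePoint.rec with
  | infty => exact exists_conj_gMap_of_infty hf hp h1
  | coe p => exact exists_conj_gMap_of_coe hf hp h1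

/-! ### Fibres and critical points of `g_B` -/

/-- Clearing denominators turns equality of values into `(z - w) * (z * w - 1) = 0`. The fibres are
thus the pairs `{z, 1/z}`, and criticality becomes being fixed by `z ↦ 1/z`. -/
theorem gMap_coe_eq_gMap_coe_iff (B : ℂ) {z w : ℂ} :
    gMap B (z : Sphere) = gMap B (w : Sphere) ↔ z = w ∨ z * w = 1 ∨ z = 0 ∧ w = 0 := by
  by_cases hz : z = 0
  · subst hz
    by_cases hw : w = 0
    · simp [hw]
    · rw [gMap_zero, gMap_coe_of_ne_zero B hw]
      simp [infty_ne_coe, Ne.symm hw, hw]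
  · by_cases hw : w = 0
    · subst hw
      rw [gMap_zero, gMap_coe_of_ne_zero B hz]
      simp [hz]
    · rw [gMap_coe_of_ne_zero B hz, gMap_coe_of_ne_zero B hw, coe_eq_coe]
      have e : z + B + 1 / z = w + B + 1 / w ↔ (z - w) * (z * w - 1) = 0 := by
        constructor
        · intro h
          field_simp at h
          linear_combination h
        · intro h
          field_simp
          linear_combination h
      rw [e, mul_eq_zero, sub_eq_zero, sub_eq_zero]
      simp [hz]

theorem not_isCriticalPoint_coe {B c : ℂ} (h : c * c ≠ 1) :
    ¬ IsCriticalPoint (gMap B) (c : Sphere) := by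
  intro hc
  have ho : IsOpen {q : ℂ × ℂ | q.1 * q.2 ≠ 1} :=
    isOpen_ne_fun (continuous_fst.mul continuous_snd) continuous_const
  obtain ⟨u, v, hu, hv, hcu, hcv, huv⟩ := isOpen_prod_iff.1 ho c c h
  refine hc ((↑) '' (u ∩ v)) (isOpenMap_coe.image_mem_nhds
    ((hu.inter hv).mem_nhds ⟨hcu, hcv⟩)) ?_
  rintro _ ⟨z, hz, rfl⟩ _ ⟨w, hw, rfl⟩ hzw
  rcases (gMap_coe_eq_gMap_coe_iff B).1 hzw with h | h | ⟨rfl, rfl⟩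
  · rw [h]
  · exact absurd h (huv (Set.mk_mem_prod hz.1 hw.2))
  · rfl

theorem not_isCriticalPoint_infty (B : ℂ) : ¬ IsCriticalPoint (gMap B) ∞ := by
  intro hc
  have hn : ((↑) '' Metric.closedBall (0 : ℂ) 1 : Set Sphere)ᶜ ∈ 𝓝 (∞ : Sphere) :=
    (isOpen_compl_image_coe.2 ⟨Metric.isClosed_closedBall, isCompact_closedBall 0 1⟩).mem_nhds
      infty_notMem_image_coe
  refine hc _ hn ?_
  have hbig : ∀ {z : ℂ}, (z : Sphere) ∈ ((↑) '' Metric.closedBall (0 : ℂ) 1 : Set Sphere)ᶜ →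
      1 < ‖z‖ := fun {z} hz => by
    by_contra h
    exact hz ⟨z, by simpa using h, rfl⟩
  have hne : ∀ {z : ℂ}, 1 < ‖z‖ → z ≠ 0 := fun {z} hz => norm_pos_iff.1 (zero_lt_one.trans hz)
  intro z hz w hw hzw
  induction z using OnePoint.rec with
  | infty =>
    induction w using OnePoint.rec with
    | infty => rfl
    | coe w =>
      rw [gMap_infty, gMap_coe_of_ne_zero B (hne (hbig hw))] at hzw
      exact absurd hzw (infty_ne_coe _)
  | coe z =>
    have hz1 := hbig hz
    induction w using OnePoint.rec with
    | infty =>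
      rw [gMap_infty, gMap_coe_of_ne_zero B (hne hz1)] at hzw
      exact absurd hzw (coe_ne_infty _)
    | coe w =>
      have hw1 := hbig hw
      rcases (gMap_coe_eq_gMap_coe_iff B).1 hzw with h | h | ⟨h, -⟩
      · rw [h]
      · have h2 := congrArg norm h
        rw [norm_mul, norm_one] at h2
        nlinarith
      · exact absurd h (hne hz1)

theorem isCriticalPoint_coe {B c : ℂ} (h : c * c = 1) :
    IsCriticalPoint (gMap B) (c : Sphere) := by
  intro U hU hinj
  have hc0 : c ≠ 0 := by
    rintro rfl
    simp at h
  have hcc : c⁻¹ = c := inv_eq_of_mul_eq_one_left h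
  rw [nhds_coe_eq, mem_map] at hU
  have h1 : ∀ᶠ z in 𝓝 c, z⁻¹ ∈ ((↑) ⁻¹' U : Set ℂ) := by
    have := continuousAt_inv₀ hc0
    rw [ContinuousAt, hcc] at this
    exact this hU
  have h2 : ∀ᶠ z in 𝓝[≠] c, z * z ≠ 1 := by
    filter_upwards [self_mem_nhdsWithin,
      nhdsWithin_le_nhds (eventually_ne_nhds (show c ≠ -c by
        intro h; exact hc0 (self_eq_neg.1 h)))] with z hz1 hz2 hz
    rcases mul_self_eq_mul_self_iff.1 (hz.trans h.symm) with h | h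
    · exact hz1 h
    · exact hz2 h
  have h3 : ∀ᶠ z in 𝓝 c, z ∈ ((↑) ⁻¹' U : Set ℂ) ∧ z⁻¹ ∈ ((↑) ⁻¹' U : Set ℂ) ∧ z ≠ 0 :=
    Filter.Eventually.and hU (h1.and (eventually_ne_nhds hc0))
  obtain ⟨z, ⟨hz1, hz2, hz4⟩, hz3⟩ := ((h3.filter_mono nhdsWithin_le_nhds).and h2).exists
  have h4 := hinj hz1 hz2 ((gMap_coe_eq_gMap_coe_iff B).2 (Or.inr (Or.inl (mul_inv_cancel₀ hz4))))
  rw [coe_eq_coe] at h4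
  refine hz3 ?_
  nth_rw 2 [h4]
  exact mul_inv_cancel₀ hz4

theorem isCriticalPoint_gMap_iff (B : ℂ) (c : Sphere) :
    IsCriticalPoint (gMap B) c ↔ c = ((1 : ℂ) : Sphere) ∨ c = ((-1 : ℂ) : Sphere) := by
  induction c using OnePoint.rec with
  | infty => simp [not_isCriticalPoint_infty, infty_ne_coe]
  | coe c =>
    rw [coe_eq_coe, coe_eq_coe, ← mul_self_eq_one_iff]
    exact ⟨fun h => by_contra fun hc => not_isCriticalPoint_coe hc h, isCriticalPoint_coe⟩

/-! ### Escape to `∞` and the Fatou set for `‖B‖ > 3` -/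

/-- The component of `z` in the direction of `B`. -/
def height (B z : ℂ) : ℝ := (starRingEnd ℂ B * z).re / ‖B‖

theorem height_add (B z w : ℂ) : height B (z + w) = height B z + height B w := by
  rw [height, height, height, mul_add, Complex.add_re, add_div]

theorem abs_height_le (B z : ℂ) : |height B z| ≤ ‖z‖ := by
  by_cases hB : B = 0
  · simp [height, hB]
  · have hB' : 0 < ‖B‖ := norm_pos_iff.2 hB
    rw [height, abs_div, abs_norm, div_le_iff₀ hB']
    refine (Complex.abs_re_le_norm _).trans_eq ?_
    rw [norm_mul, Complex.norm_conj, mul_comm]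

theorem height_self (B : ℂ) : height B B = ‖B‖ := by
  by_cases hB : B = 0
  · simp [height, hB]
  · have hB' : ‖B‖ ≠ 0 := norm_ne_zero_iff.2 hB
    rw [height, mul_comm, Complex.mul_conj, Complex.ofReal_re, Complex.normSq_eq_norm_sq]
    field_simp

theorem continuous_height (B : ℂ) : Continuous (height B) :=
  (Complex.continuous_re.comp (continuous_const.mul continuous_id)).div_const _

theorem height_neg_le (B z : ℂ) : -‖z‖ ≤ height B z :=
  (abs_le.1 (abs_height_le B z)).1

theorem height_le (B z : ℂ) : height B z ≤ ‖z‖ :=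
  (abs_le.1 (abs_height_le B z)).2

theorem ne_zero_of_height_pos {B z : ℂ} (h : 0 < height B z) : z ≠ 0 := by
  rintro rfl
  simp [height] at h

/-- If `|B| > 3`, the iterates of `g_B` on the half-plane of points of height greater than `1`
remain in `ℂ` and gain height linearly. -/
theorem exists_iterate_gMap_eq {B z : ℂ} (hB : 3 < ‖B‖) (hz : 1 < height B z) (n : ℕ) :
    ∃ w : ℂ, (gMap B)^[n] (z : Sphere) = w ∧ n + 1 < height B w := by
  induction n with
  | zero => exact ⟨z, rfl, by simpa using hz⟩
  | succ n ih =>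
    obtain ⟨w, hw, hwn⟩ := ih
    have hn : (0 : ℝ) ≤ n := n.cast_nonneg
    have hw0 : w ≠ 0 := ne_zero_of_height_pos (B := B) (by linarith)
    refine ⟨w + B + 1 / w, ?_, ?_⟩
    · rw [Function.iterate_succ_apply', hw, gMap_coe_of_ne_zero B hw0]
    · have h1 : 1 ≤ ‖w‖ := by linarith [height_le B w]
      have h2 : ‖1 / w‖ ≤ 1 := by
        rw [norm_div, norm_one]
        exact (div_le_one (by linarith)).2 h1
      have h3 := height_neg_le B (1 / w)
      rw [height_add, height_add, height_self]
      push_cast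
      linarith

/-- The points of `ℂ` which `g_B` sends to a finite point of height greater than `1`. -/
def preHalfPlane (B : ℂ) : Set ℂ := {z | z ≠ 0 ∧ 1 < height B (z + B + 1 / z)}

theorem isOpen_preHalfPlane (B : ℂ) : IsOpen (preHalfPlane B) := by
  refine isOpen_iff_mem_nhds.2 fun z hz => ?_
  have hc : ContinuousAt (fun z : ℂ => height B (z + B + 1 / z)) z := by
    refine (continuous_height B).continuousAt.comp ?_
    exact (continuousAt_id.add continuousAt_const).add (continuousAt_const.div continuousAt_id hz.1)
  filter_upwards [eventually_ne_nhds hz.1, hc.eventually (lt_mem_nhds hz.2)] with w h1 h2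
  exact ⟨h1, h2⟩

theorem exists_iterate_gMap_eq_of_mem {B z : ℂ} (hB : 3 < ‖B‖) (hz : z ∈ preHalfPlane B) (n : ℕ) :
    ∃ w : ℂ, w ≠ 0 ∧ (gMap B)^[n] (z : Sphere) = w ∧ (n ≠ 0 → n < ‖w‖) := by
  cases n with
  | zero => exact ⟨z, hz.1, rfl, by simp⟩
  | succ n =>
    obtain ⟨w, hw, hn⟩ := exists_iterate_gMap_eq hB hz.2 n
    have hn0 : (0 : ℝ) ≤ n := n.cast_nonneg
    refine ⟨w, ne_zero_of_height_pos (B := B) (by linarith), ?_, fun _ => ?_⟩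
    · rw [Function.iterate_succ_apply, gMap_coe_of_ne_zero B hz.1, hw]
    · push_cast
      linarith [height_le B w]

/-- Both `z` and `1/z` have height at least `-1`, so the image has height at least `‖B‖ - 2`. The
constant `3` is what makes this exceed `1`. -/
theorem mem_preHalfPlane_of_norm_eq_one {B z : ℂ} (hB : 3 < ‖B‖) (hz : ‖z‖ = 1) :
    z ∈ preHalfPlane B := by
  refine ⟨norm_ne_zero_iff.1 (by simp [hz]), ?_⟩
  rw [height_add, height_add, height_self]
  have h1 := height_neg_le B z
  have h2 := height_neg_le B (1 / z)
  rw [norm_div, norm_one, hz, div_one] at h2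
  linarith

theorem exists_forall_coe_mem_of_mem_nhds_infty {T : Set Sphere} (hT : T ∈ 𝓝 ∞) :
    ∃ n₀ : ℕ, ∀ w : ℂ, (n₀ : ℝ) < ‖w‖ → (w : Sphere) ∈ T := by
  have h : ((↑) ⁻¹' T : Set ℂ) ∈ Bornology.cobounded ℂ := by
    rw [Metric.cobounded_eq_cocompact, ← coclosedCompact_eq_cocompact]
    exact tendsto_coe_infty hT
  rw [← comap_norm_atTop, mem_comap] at h
  obtain ⟨t, ht, htT⟩ := h
  obtain ⟨r, hr⟩ := mem_atTop_sets.1 ht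
  obtain ⟨n₀, hn₀⟩ := exists_nat_ge r
  exact ⟨n₀, fun w hw => htT (hr _ (hn₀.trans hw.le))⟩

/-- The iterates of `g_B` converge to `∞` uniformly on the preimage of the half-plane. -/
theorem exists_forall_iterate_mem {B : ℂ} (hB : 3 < ‖B‖) {T : Set Sphere} (hT : T ∈ 𝓝 ∞) :
    ∃ n₀ : ℕ, ∀ n ≥ n₀, ∀ z ∈ preHalfPlane B, (gMap B)^[n] (z : Sphere) ∈ T := by
  obtain ⟨n₀, hn₀⟩ := exists_forall_coe_mem_of_mem_nhds_infty hT
  refine ⟨n₀ + 1, fun n hn z hz => ?_⟩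
  obtain ⟨w, -, hw, hnw⟩ := exists_iterate_gMap_eq_of_mem hB hz n
  rw [hw]
  refine hn₀ w (lt_of_le_of_lt ?_ (hnw (by omega)))
  exact_mod_cast (Nat.le_succ n₀).trans hn

theorem tendsto_iterate_gMap {B z : ℂ} (hB : 3 < ‖B‖) (hz : z ∈ preHalfPlane B) :
    Tendsto (fun n : ℕ => (gMap B)^[n] (z : Sphere)) atTop (𝓝 ∞) := by
  intro T hT
  obtain ⟨n₀, hn₀⟩ := exists_forall_iterate_mem hB hT
  exact mem_map.2 (mem_atTop_sets.2 ⟨n₀, fun n hn => hn₀ n hn z hz⟩)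

theorem continuousAt_gMap_coe (B : ℂ) {w : ℂ} (hw : w ≠ 0) :
    ContinuousAt (gMap B) (w : Sphere) := by
  rw [continuousAt_coe]
  have h : ContinuousAt (fun z : ℂ => ((z + B + 1 / z : ℂ) : Sphere)) w :=
    ContinuousAt.comp continuous_coe.continuousAt
      ((continuousAt_id.add continuousAt_const).add (continuousAt_const.div continuousAt_id hw))
  refine h.congr ?_
  filter_upwards [eventually_ne_nhds hw] with z hz
  exact (gMap_coe_of_ne_zero B hz).symm

theorem continuousAt_iterate_gMap {B z : ℂ} (hB : 3 < ‖B‖) (hz : z ∈ preHalfPlane B) (n : ℕ) :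
    ContinuousAt (gMap B)^[n] (z : Sphere) := by
  induction n with
  | zero => exact continuousAt_id
  | succ n ih =>
    rw [Function.iterate_succ']
    obtain ⟨w, hw0, hw, -⟩ := exists_iterate_gMap_eq_of_mem hB hz n
    refine ContinuousAt.comp ?_ ih
    rw [hw]
    exact continuousAt_gMap_coe B hw0

attribute [local instance] sphereUniformSpace

/-- Finitely many iterates are handled by continuity; all later ones send both points close to `∞`,
by uniform convergence. -/
theorem equicontinuousAt_iterate_gMap {B z : ℂ} (hB : 3 < ‖B‖) (hz : z ∈ preHalfPlane B) :
    EquicontinuousAt (fun n => (gMap B)^[n]) (z : Sphere) := by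
  intro V hV
  obtain ⟨W, hW, hWs, hWV⟩ := comp_symm_mem_uniformity_sets hV
  obtain ⟨n₀, hn₀⟩ := exists_forall_iterate_mem hB (UniformSpace.ball_mem_nhds ∞ hW)
  have h1 : ∀ᶠ x in 𝓝 (z : Sphere), ∀ n < n₀, ((gMap B)^[n] z, (gMap B)^[n] x) ∈ V := by
    refine (Set.finite_lt_nat n₀).eventually_all.2 fun n _ => ?_
    exact (continuousAt_iterate_gMap hB hz n) (UniformSpace.ball_mem_nhds _ hV)
  have h2 : ∀ᶠ x in 𝓝 (z : Sphere), x ∈ ((↑) '' preHalfPlane B : Set Sphere) :=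
    isOpenMap_coe.image_mem_nhds ((isOpen_preHalfPlane B).mem_nhds hz)
  filter_upwards [h1, h2] with x hx1 hx2 n
  obtain ⟨w, hw, rfl⟩ := hx2
  rcases lt_or_ge n n₀ with hn | hn
  · exact hx1 n hn
  · exact hWV ⟨∞, hWs.symm _ _ (hn₀ n hn z hz), hn₀ n hn w hw⟩

theorem coe_mem_fatouSet {B z : ℂ} (hB : 3 < ‖B‖) (hz : z ∈ preHalfPlane B) :
    (z : Sphere) ∈ fatouSet (gMap B) := by
  refine ⟨(↑) '' preHalfPlane B, isOpen_image_coe.2 (isOpen_preHalfPlane B), ⟨z, hz, rfl⟩, ?_⟩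
  rintro _ ⟨w, hw, rfl⟩
  exact equicontinuousAt_iterate_gMap hB hw

/-! ### The points `0` and `∞` in the Julia set -/

/-- The point `0` has a backward orbit outside the unit disc that tends to `∞`. -/
theorem exists_backward_orbit {B : ℂ} (hB : 3 < ‖B‖) (n : ℕ) :
    ∃ z : ℂ, (gMap B)^[n] (z : Sphere) = ((0 : ℂ) : Sphere) ∧ height B z ≤ -n := by
  induction n with
  | zero => exact ⟨0, rfl, by simp [height]⟩
  | succ n ih =>
    obtain ⟨w, hw, hwn⟩ := ih
    obtain ⟨s, hs⟩ := IsAlgClosed.exists_pow_nat_eq ((B - w) ^ 2 - 4) (n := 2) (by norm_num)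
    -- The two preimages of `w` have product `1`, so one of them lies outside the open unit disc;
    -- passing to it lowers the height by at least `‖B‖ - 1`.
    obtain ⟨z, hz, hz1⟩ : ∃ z : ℂ, z ^ 2 + (B - w) * z + 1 = 0 ∧ 1 ≤ ‖z‖ := by
      by_contra! hcon
      have h1 := hcon ((w - B + s) / 2) (by linear_combination hs / 4)
      have h2 := hcon ((w - B - s) / 2) (by linear_combination hs / 4)
      have h3 : (w - B + s) / 2 * ((w - B - s) / 2) = 1 := by linear_combination -hs / 4
      have h4 := congrArg norm h3
      rw [norm_mul, norm_one] at h4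
      nlinarith [norm_nonneg ((w - B + s) / 2), norm_nonneg ((w - B - s) / 2)]
    have hz0 : z ≠ 0 := norm_pos_iff.1 (by linarith)
    have hgz : z + B + 1 / z = w := by
      field_simp
      linear_combination hz
    refine ⟨z, ?_, ?_⟩
    · rw [Function.iterate_succ_apply, gMap_coe_of_ne_zero B hz0, hgz, hw]
    · have h1 : height B w = height B z + ‖B‖ + height B (1 / z) := by
        rw [← hgz, height_add, height_add, height_self]
      have h2 := height_neg_le B (1 / z)
      have h3 : ‖1 / z‖ ≤ 1 := by
        rw [norm_div, norm_one]
        exact (div_le_one (by linarith)).2 hz1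
      push_cast
      linarith

/-- Every neighbourhood of `∞` contains a point with an iterate equal to `0`. -/
theorem exists_mem_iterate_eq_zero {B : ℂ} (hB : 3 < ‖B‖) {T : Set Sphere} (hT : T ∈ 𝓝 ∞) :
    ∃ z : ℂ, z ≠ 0 ∧ (z : Sphere) ∈ T ∧ ∃ n : ℕ, (gMap B)^[n] (z : Sphere) = ((0 : ℂ) : Sphere) := by
  obtain ⟨n₀, hn₀⟩ := exists_forall_coe_mem_of_mem_nhds_infty hT
  obtain ⟨z, hz, hzn⟩ := exists_backward_orbit hB (n₀ + 1)
  have h := height_neg_le B z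
  push_cast at hzn
  have hn : (0 : ℝ) ≤ n₀ := n₀.cast_nonneg
  exact ⟨z, norm_pos_iff.1 (by linarith), hn₀ z (by linarith), _, hz⟩

/-- An entourage separating `∞` from `0` defeats equicontinuity. Only iterates from the first on are
used, so that `p = 0`, which reaches `∞` after one step, is covered too. -/
theorem mem_juliaSet_of_forall_nhds {f : Sphere → Sphere} {p : Sphere}
    (hp : ∀ n, f^[n + 1] p = ∞)
    (h : ∀ T ∈ 𝓝 p, ∃ z ∈ T, ∃ n, f^[n + 1] z = ((0 : ℂ) : Sphere)) : p ∈ juliaSet f := by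
  rintro ⟨U, -, hpU, hU⟩
  have h0 : ({((0 : ℂ) : Sphere)}ᶜ : Set Sphere) ∈ 𝓝 (∞ : Sphere) :=
    isOpen_compl_singleton.mem_nhds (infty_ne_coe _)
  obtain ⟨V, hV, hV0⟩ := UniformSpace.mem_nhds_iff.1 h0
  obtain ⟨z, hz, n, hzn⟩ := h _ (hU p hpU V hV)
  have h1 := hz (n + 1)
  simp only [hp, hzn] at h1
  exact hV0 h1 rfl

theorem iterate_gMap_infty (B : ℂ) (n : ℕ) : (gMap B)^[n] ∞ = ∞ :=
  Function.iterate_fixed (gMap_infty B) n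

theorem infty_mem_juliaSet {B : ℂ} (hB : 3 < ‖B‖) : ∞ ∈ juliaSet (gMap B) := by
  refine mem_juliaSet_of_forall_nhds (fun n => iterate_gMap_infty B _) fun T hT => ?_
  obtain ⟨z, hz0, hzT, n, hn⟩ := exists_mem_iterate_eq_zero hB hT
  have hn0 : n ≠ 0 := by
    rintro rfl
    exact hz0 (coe_injective hn)
  exact ⟨z, hzT, n - 1, by rwa [Nat.sub_add_cancel (Nat.one_le_iff_ne_zero.2 hn0)]⟩

theorem zero_mem_juliaSet {B : ℂ} (hB : 3 < ‖B‖) : ((0 : ℂ) : Sphere) ∈ juliaSet (gMap B) := by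
  refine mem_juliaSet_of_forall_nhds (fun n => ?_) fun T hT => ?_
  · rw [Function.iterate_succ_apply, gMap_zero, iterate_gMap_infty]
  · rw [← inversion_smul_infty] at hT
    obtain ⟨z, hz0, hzT, n, hn⟩ :=
      exists_mem_iterate_eq_zero hB (continuous_inversion_smul.continuousAt hT)
    have hn0 : n ≠ 0 := by
      rintro rfl
      exact hz0 (coe_injective hn)
    refine ⟨_, hzT, n - 1, ?_⟩
    -- The points near `∞` that land on `0` are inverted to points near `0`; from the first iterate
    -- on, the orbits agree.
    have h1 : gMap B (inversion • (z : Sphere)) = gMap B (z : Sphere) := by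
      rw [inversion_smul_coe_of_ne_zero hz0, gMap_coe_eq_gMap_coe_iff]
      exact Or.inr (Or.inl (inv_mul_cancel₀ hz0))
    rw [Function.iterate_succ_apply, h1, ← Function.iterate_succ_apply, Nat.succ_eq_add_one,
      Nat.sub_add_cancel (Nat.one_le_iff_ne_zero.2 hn0), hn]

/-- If `|B| > 3`, the unit circle lies in the Fatou set of `g_B` and separates `0` from `∞`, both
of which are in the Julia set. -/
theorem not_isPreconnected_juliaSet {B : ℂ} (hB : 3 < ‖B‖) :
    ¬ IsPreconnected (juliaSet (gMap B)) := by
  intro h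
  have ho : IsOpen ((↑) '' Metric.ball (0 : ℂ) 1 : Set Sphere) :=
    isOpen_image_coe.2 Metric.isOpen_ball
  have ho' : IsOpen ((↑) '' Metric.closedBall (0 : ℂ) 1 : Set Sphere)ᶜ :=
    isOpen_compl_image_coe.2 ⟨Metric.isClosed_closedBall, isCompact_closedBall 0 1⟩
  have hsub : juliaSet (gMap B) ⊆ ((↑) '' Metric.ball (0 : ℂ) 1 : Set Sphere) ∪
      ((↑) '' Metric.closedBall (0 : ℂ) 1 : Set Sphere)ᶜ := by
    intro z hz
    by_contra hcon
    rw [Set.mem_union, not_or, Set.mem_compl_iff, not_not] at hcon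
    obtain ⟨h1, w, hw, rfl⟩ := hcon
    refine hz (coe_mem_fatouSet hB (mem_preHalfPlane_of_norm_eq_one hB (le_antisymm ?_ ?_)))
    · simpa using hw
    · by_contra hlt
      exact h1 ⟨w, by simpa using hlt, rfl⟩
  obtain ⟨_, -, ⟨w, hw, rfl⟩, h2⟩ := h _ _ ho ho' hsub
    ⟨_, zero_mem_juliaSet hB, 0, Metric.mem_ball_self one_pos, rfl⟩
    ⟨_, infty_mem_juliaSet hB, infty_notMem_image_coe⟩
  exact h2 ⟨w, Metric.ball_subset_closedBall hw, rfl⟩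

theorem tendsto_iterate_gMap_of_isCriticalPoint {B : ℂ} (hB : 3 < ‖B‖) {c : Sphere}
    (hc : IsCriticalPoint (gMap B) c) :
    Tendsto (fun n : ℕ => (gMap B)^[n] c) atTop (𝓝 ∞) := by
  rcases (isCriticalPoint_gMap_iff B c).1 hc with rfl | rfl
  · exact tendsto_iterate_gMap hB (mem_preHalfPlane_of_norm_eq_one hB (by simp))
  · exact tendsto_iterate_gMap hB (mem_preHalfPlane_of_norm_eq_one hB (by simp))

/-! ### Conjugation invariance of the Julia set -/

theorem iterate_smul_of_conj {f g : Sphere → Sphere} {M : GL (Fin 2) ℂ}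
    (hM : ∀ z, g (M • z) = M • f z) (n : ℕ) (z : Sphere) : g^[n] (M • z) = M • f^[n] z :=
  (((show Function.Semiconj (fun z : Sphere => M • z) f g from fun z => (hM z).symm).iterate_right
    n) z).symm

theorem smul_mem_fatouSet {f g : Sphere → Sphere} {M : GL (Fin 2) ℂ}
    (hM : ∀ z, g (M • z) = M • f z) {z : Sphere} (hz : z ∈ fatouSet f) :
    M • z ∈ fatouSet g := by
  obtain ⟨U, hU, hzU, hf⟩ := hz
  refine ⟨(fun w : Sphere => M⁻¹ • w) ⁻¹' U, hU.preimage (continuous_smul_sphere M⁻¹), ?_, ?_⟩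
  · rwa [Set.mem_preimage, inv_smul_smul]
  · intro w hw V hV
    -- Compactness makes `M` uniformly continuous, so equicontinuity survives composition with it.
    have hu := CompactSpace.uniformContinuous_of_continuous (continuous_smul_sphere M) hV
    have h1 := (continuous_smul_sphere M⁻¹).continuousAt.eventually (hf _ hw _ hu)
    filter_upwards [h1] with x hx n
    have h2 := hx n
    simp only [Set.mem_preimage, ← iterate_smul_of_conj hM, smul_inv_smul] at h2
    exact h2

theorem smul_mem_fatouSet_iff {f g : Sphere → Sphere} {M : GL (Fin 2) ℂ}
    (hM : ∀ z, g (M • z) = M • f z) {z : Sphere} : M • z ∈ fatouSet g ↔ z ∈ fatouSet f := by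
  refine ⟨fun h => ?_, smul_mem_fatouSet hM⟩
  have h1 := smul_mem_fatouSet (f := g) (g := f) (M := M⁻¹)
    (fun w => by rw [eq_inv_smul_iff, ← hM, smul_inv_smul]) h
  rwa [inv_smul_smul] at h1

theorem image_juliaSet {f g : Sphere → Sphere} {M : GL (Fin 2) ℂ}
    (hM : ∀ z, g (M • z) = M • f z) :
    (fun z : Sphere => M • z) '' juliaSet f = juliaSet g := by
  ext z
  constructor
  · rintro ⟨w, hw, rfl⟩
    exact fun h => hw ((smul_mem_fatouSet_iff hM).1 h)
  · intro hz
    refine ⟨M⁻¹ • z, fun h => hz ?_, smul_inv_smul _ _⟩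
    rwa [← smul_mem_fatouSet_iff hM, smul_inv_smul] at h

/-! ### The parameter `λ = 1 - B²` and the bound -/

/-- The class of `g_B` in the moduli space. -/
def gCls (B : ℂ) : Moduli := cls ⟨gMap B, isQuadratic_gMap B⟩

theorem exists_conj_of_cls_eq {f : {f : Sphere → Sphere // IsQuadratic f}} {B : ℂ}
    (h : cls f = gCls B) : ∃ M : GL (Fin 2) ℂ, ∀ z, gMap B (M • z) = M • f.1 z :=
  Quotient.exact h

theorem isParameter_gCls_iff (B l : ℂ) : IsParameter (gCls B) l ↔ l = 1 - B ^ 2 := by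
  constructor
  · rintro ⟨f, hf, hl⟩
    obtain ⟨M, hM⟩ := exists_conj_of_cls_eq hf
    refine (isOtherEigenvalue_iff_of_conj (M := M⁻¹) (fun z => ?_) l).1 hl
    rw [eq_inv_smul_iff, ← hM, smul_inv_smul]
  · intro hl
    exact ⟨_, rfl, (isOtherEigenvalue_iff_of_conj (M := 1) (fun z => by simp) l).2 hl⟩

theorem gCls_mem_perOneOne (B : ℂ) : gCls B ∈ PerOneOne :=
  ⟨_, rfl, ∞, rfl, (hasMultiplier_gMap_infty B).eigenvalue_eq⟩

theorem exists_eq_gCls {c : Moduli} (hc : c ∈ PerOneOne) : ∃ B, c = gCls B := by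
  obtain ⟨f, rfl, p, hp, h1⟩ := hc
  obtain ⟨B, M, hM⟩ := exists_conj_gMap f.2 hp h1
  exact ⟨B, Quotient.sound ⟨M, hM⟩⟩

theorem gCls_neg (B : ℂ) : gCls (-B) = gCls B :=
  (Quotient.sound ⟨_, gMap_neg_conj B⟩ : gCls B = gCls (-B)).symm

theorem existsUnique_isParameter {c : Moduli} (hc : c ∈ PerOneOne) :
    ∃! l : ℂ, IsParameter c l := by
  obtain ⟨B, rfl⟩ := exists_eq_gCls hc
  exact ⟨1 - B ^ 2, (isParameter_gCls_iff _ _).2 rfl, fun l hl => (isParameter_gCls_iff _ _).1 hl⟩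

theorem existsUnique_moduli (l : ℂ) : ∃! c : Moduli, c ∈ PerOneOne ∧ IsParameter c l := by
  obtain ⟨B, hB⟩ := IsAlgClosed.exists_pow_nat_eq (1 - l) (n := 2) (by norm_num)
  refine ⟨gCls B, ⟨gCls_mem_perOneOne B, (isParameter_gCls_iff _ _).2 ?_⟩, ?_⟩
  · rw [hB, sub_sub_cancel]
  · rintro c ⟨hc, hl⟩
    obtain ⟨D, rfl⟩ := exists_eq_gCls hc
    have h : D ^ 2 = B ^ 2 := by linear_combination (isParameter_gCls_iff _ _).1 hl - hB
    rcases sq_eq_sq_iff_eq_or_eq_neg.1 h with rfl | rfl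
    · rfl
    · exact gCls_neg B

theorem norm_sub_one_le_of_mem_MOne {c : Moduli} (hc : c ∈ MOne) {l : ℂ} (hl : IsParameter c l) :
    ‖l - 1‖ ≤ 9 := by
  obtain ⟨hc1, f, hf, hJ⟩ := hc
  obtain ⟨B, rfl⟩ := exists_eq_gCls hc1
  obtain ⟨M, hM⟩ := exists_conj_of_cls_eq hf
  have hB : ‖B‖ ≤ 3 := by
    by_contra! hB
    refine not_isPreconnected_juliaSet hB ?_
    rw [← image_juliaSet hM]
    exact hJ.isPreconnected.image _ (continuous_smul_sphere M).continuousOn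
  rw [(isParameter_gCls_iff _ _).1 hl, sub_sub_cancel_left, norm_neg, norm_pow]
  nlinarith [norm_nonneg B]

end

end QuadRat

theorem lemma4p1 :
    -- the eigenvalue at the other fixed point parametrizes `Per₁(1)` by the complex plane
    ((∀ c ∈ QuadRat.PerOneOne, ∃! l : ℂ, QuadRat.IsParameter c l) ∧
      (∀ l : ℂ, ∃! c : QuadRat.Moduli, c ∈ QuadRat.PerOneOne ∧ QuadRat.IsParameter c l)) ∧
    -- the bound on `M₁` in this parameter
    {l : ℂ | ∃ c ∈ QuadRat.MOne, QuadRat.IsParameter c l} ⊆ {l : ℂ | ‖l - 1‖ ≤ 9} ∧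
    -- the maps `g_B` with `|B| > 3`
    (∀ B : ℂ, 3 < ‖B‖ →
      (∀ c : QuadRat.Sphere, QuadRat.IsCriticalPoint (QuadRat.gMap B) c ↔
        c = ((1 : ℂ) : QuadRat.Sphere) ∨ c = ((-1 : ℂ) : QuadRat.Sphere)) ∧
      (∀ c : QuadRat.Sphere, QuadRat.IsCriticalPoint (QuadRat.gMap B) c →
        Tendsto (fun n : ℕ => (QuadRat.gMap B)^[n] c) atTop (𝓝 ∞)) ∧
      ¬ IsPreconnected (QuadRat.juliaSet (QuadRat.gMap B))) := by
  refine ⟨⟨fun c hc => QuadRat.existsUnique_isParameter hc, QuadRat.existsUnique_moduli⟩, ?_,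
    fun B hB => ⟨QuadRat.isCriticalPoint_gMap_iff B,
      fun c hc => QuadRat.tendsto_iterate_gMap_of_isCriticalPoint hB hc,
      QuadRat.not_isPreconnected_juliaSet hB⟩⟩
  rintro l ⟨c, hc, hl⟩
  exact QuadRat.norm_sub_one_le_of_mem_MOne hc hl
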